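/- Let $G=(V,E)$ be a finite undirected graph in which every vertex $v$ has degree $d(v)\ge 1$, and write $v\sim w$ for $\{v,w\}\in E$. For every agent $v\in V$ let $f_v:\mathbb R\to\mathbb R$ be convex, and suppose that $\inf_{a\in\mathbb R}\sum_{v\in V} f_v(a)$ is attained. Let $\lambda>0$ and $\rho>0$, put $\|x\|_{\mathrm{TV}}=\sum_{\{v,w\}\in E}|x(v)-x(w)|$ for $x\in\mathbb R^V$, and consider the regularized problem $$\min_{x\in\mathbb R^V}\ \sum_{v\in V} f_v(x(v))+\lambda\|x\|_{\mathrm{TV}}.\qquad(\ast)$$ Denote by $\mathrm{proj}_{[-\omega,\omega]}$ the projection of $\mathbb R$ onto $[-\omega,\omega]$ and put $\mathrm{prox}_{f,c}(x)=\arg\min_{y\in\mathbb R}\, f(y)+\frac c2(y-x)^2$. Suppose that all agents are regular, that is, all of them follow the ADMM-based distributed algorithm: $x_0\in\mathbb R^V$ is arbitrary, the initial values $\mu_0(w,v)$ (for $w\sim v$) satisfy $\mu_0(w,v)=-\mu_0(v,w)$ and are otherwise arbitrary, and for all $n\ge 0$ and $v\in V$ $$\mu_{n+1}(w,v)=\mathrm{proj}_{[-2\lambda/\rho,\,2\lambda/\rho]}\bigl(\mu_n(w,v)+x_n(w)-x_n(v)\bigr)\quad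 (w\sim v),$$ $$x_{n+1}(v)=\mathrm{prox}_{f_v,\,\rho d(v)}\Bigl(x_n(v)+\tilde\mu_{n+1}(v)-\tfrac12\tilde\mu_n(v)\Bigr),\qquad \tilde\mu_n(v)=\frac1{d(v)}\sum_{w\sim v}\mu_n(w,v).$$ Then the following holds. 1. The sequence $(x_n)$ is generated by ADMM: there are $z_n(v,w),\eta_n(v,w)$ (for $v\sim w$, $n\ge 0$), with $\eta_n(v,w)=\frac\rho2\mu_{n+1}(v,w)$, such that for all $n\ge 0$: $x_{n+1}$ minimizes $\mathcal L(\cdot,z_n;\eta_n)$, $z_{n+1}$ minimizes $\mathcal L(x_{n+1},\cdot\,;\eta_n)$, and $\eta_{n+1}(v,w)=\eta_n(v,w)+\rho\,(z_{n+1}(v,w)-x_{n+1}(w))$ for all $v\sim w$, where $$\mathcal L(x,z;\eta)=\sum_{v} f_v(x(v))+\sum_{\{v,w\}\in E}\lambda|z(v,w)-z(w,v)|+\sum_{(v,w):\,v\sim w}\Bigl(\eta(v,w)(z(v,w)-x(w))+\tfrac\rho2(z(v,w)-x(w))^2\Bigr).$$ 2. If $(\ast)$ has a minimizer, then $(x_n)$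 converges to a minimizer of $(\ast)$. 3. In the average consensus case $f_v(y)=\frac12(y-x_0(v))^2$ for all $v$, if $G$ is $d$-regular for some $d$, then the average is preserved: $\frac1{|V|}\sum_v x_n(v)=\frac1{|V|}\sum_v x_0(v)$ for all $n\ge 0$. -/

import Mathlib

open Filter Topology

namespace TVConsensus

noncomputable section

/-- The total variation `∑_{{v,w} ∈ E} |x(v) - x(w)|` (one term for each unordered edge). -/
def tv {V : Type*} [Fintype V] [DecidableEq V] (G : SimpleGraph V) [DecidableRel G.Adj]
    (x : V → ℝ) : ℝ :=
  ∑ e ∈ G.edgeFinset, Sym2.lift ⟨fun v w => |x v - x w|, fun v w => abs_sub_comm (x v) (x w)⟩ e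

/-- The regularized energy `∑_v f_v(x(v)) + lam ‖x‖_TV`. -/
def energy {V : Type*} [Fintype V] [DecidableEq V] (G : SimpleGraph V) [DecidableRel G.Adj]
    (f : V → ℝ → ℝ) (lam : ℝ) (x : V → ℝ) : ℝ :=
  ∑ v, f v (x v) + lam * tv G x

/-- `x` is a minimizer over `ℝ^V` of the regularized energy. -/
def IsRegMinimizer {V : Type*} [Fintype V] [DecidableEq V] (G : SimpleGraph V)
    [DecidableRel G.Adj] (f : V → ℝ → ℝ) (lam : ℝ) (x : V → ℝ) : Prop :=
  ∀ y : V → ℝ, energy G f lam x ≤ energy G f lam y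

/-- The average of `x` over the network. -/
def average {V : Type*} [Fintype V] (x : V → ℝ) : ℝ :=
  (∑ v, x v) / (Fintype.card V : ℝ)

/-- `y` minimizes `f(y) + (c/2) (y - x)²` over the reals. -/
def IsProx (f : ℝ → ℝ) (c x y : ℝ) : Prop :=
  ∀ z : ℝ, f y + c / 2 * (y - x) ^ 2 ≤ f z + c / 2 * (z - x) ^ 2

/-- The proximal operator `prox_{f,c}(x) = argmin_y f(y) + (c/2) (y - x)²`; for convex `f` and
`c > 0` the minimizer exists and is unique, see `prox_spec` and `IsProx.unique`. -/
def prox (f : ℝ → ℝ) (c x : ℝ) : ℝ :=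
  Classical.epsilon (IsProx f c x)

/-- The projection of the real number `x` onto the interval `[-ω, ω]` (for `0 ≤ ω`). -/
def projInterval (ω x : ℝ) : ℝ :=
  max (-ω) (min ω x)

/-- `μ̃(v) = (1/d(v)) ∑_{w ∼ v} μ(w,v)`. -/
def nbrAverage {V : Type*} [Fintype V] [DecidableEq V] (G : SimpleGraph V) [DecidableRel G.Adj]
    (μ : V → V → ℝ) (v : V) : ℝ :=
  (1 / (G.degree v : ℝ)) * ∑ w ∈ G.neighborFinset v, μ w v

/-- The sequences `(x_n)` and `(μ_n)` are generated by the ADMM-based distributed algorithm with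
all agents regular: every agent performs the update at every time. The variable `μ n w v` (held
by agent `v`) is meaningful only for `w ∼ v`. The initial `x 0` is arbitrary, and the initial
`μ 0` is antisymmetric on the edges, as a (rescaled) multiplier of the edge constraints is. -/
structure IsDistributedADMM {V : Type*} [Fintype V] [DecidableEq V] (G : SimpleGraph V)
    [DecidableRel G.Adj] (f : V → ℝ → ℝ) (lam ρ : ℝ)
    (x : ℕ → V → ℝ) (μ : ℕ → V → V → ℝ) : Prop where
  init_antisymm : ∀ v w : V, G.Adj v w → μ 0 w v = -μ 0 v w
  mu_update : ∀ (n : ℕ) (v w : V), G.Adj v w →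
    μ (n + 1) w v = projInterval (2 * lam / ρ) (μ n w v + x n w - x n v)
  x_update : ∀ (n : ℕ) (v : V),
    x (n + 1) v = prox (f v) (ρ * (G.degree v : ℝ))
      (x n v + nbrAverage G (μ (n + 1)) v - 1 / 2 * nbrAverage G (μ n) v)

/-- The augmented Lagrangian of the problem
`min ∑_v f_v(x(v)) + lam ∑_{{v,w} ∈ E} |z(v,w) - z(w,v)|` subject to `z(v,w) = x(w)` for all
ordered pairs `(v,w)` of adjacent vertices. A function on these ordered pairs is written as a
function of two vertices; its values on non-adjacent pairs play no role. -/
def augLagrangian {V : Type*} [Fintype V] [DecidableEq V] (G : SimpleGraph V) [DecidableRel G.Adj]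
    (f : V → ℝ → ℝ) (lam ρ : ℝ) (x : V → ℝ) (z η : V → V → ℝ) : ℝ :=
  ∑ v, f v (x v)
    + ∑ e ∈ G.edgeFinset,
        Sym2.lift ⟨fun v w => lam * |z v w - z w v|,
          fun v w => congrArg (lam * ·) (abs_sub_comm (z v w) (z w v))⟩ e
    + ∑ v, ∑ w ∈ G.neighborFinset v,
        (η v w * (z v w - x w) + ρ / 2 * (z v w - x w) ^ 2)

/-- The sequences `(x_n)`, `(z_n)`, `(η_n)` are generated by the alternating direction method of
multipliers for the augmented Lagrangian above. -/
structure IsADMM {V : Type*} [Fintype V] [DecidableEq V] (G : SimpleGraph V)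
    [DecidableRel G.Adj] (f : V → ℝ → ℝ) (lam ρ : ℝ)
    (x : ℕ → V → ℝ) (z η : ℕ → V → V → ℝ) : Prop where
  x_update : ∀ (n : ℕ) (y : V → ℝ),
    augLagrangian G f lam ρ (x (n + 1)) (z n) (η n) ≤ augLagrangian G f lam ρ y (z n) (η n)
  z_update : ∀ (n : ℕ) (y : V → V → ℝ),
    augLagrangian G f lam ρ (x (n + 1)) (z (n + 1)) (η n)
      ≤ augLagrangian G f lam ρ (x (n + 1)) y (η n)
  eta_update : ∀ (n : ℕ) (v w : V), G.Adj v w →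
    η (n + 1) v w = η n v w + ρ * (z (n + 1) v w - x (n + 1) w)

theorem exists_isProx {f : ℝ → ℝ} (hf : ConvexOn ℝ Set.univ f) {c : ℝ} (hc : 0 < c) (x : ℝ) :
    ∃ y, IsProx f c x y := by
  have hcont : Continuous f := by
    rw [← continuousOn_univ]
    exact hf.continuousOn isOpen_univ
  have key : ∀ s : ℝ, |s| = 1 → ∀ t : ℝ, 1 ≤ t → f x + t * (f (x + s) - f x) ≤ f (x + t * s) := by
    intro s _ t ht
    have h0 : (0 : ℝ) < t := by linarith
    have h := hf.2 (Set.mem_univ x) (Set.mem_univ (x + t * s))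
      (show (0 : ℝ) ≤ 1 - 1 / t by rw [sub_nonneg, div_le_one h0]; exact ht)
      (show (0 : ℝ) ≤ 1 / t by positivity) (by ring)
    have e : (1 - 1 / t) • x + (1 / t) • (x + t * s) = x + s := by
      simp only [smul_eq_mul]; field_simp; ring
    rw [e] at h
    simp only [smul_eq_mul] at h
    have h2 := mul_le_mul_of_nonneg_left h h0.le
    have e2 : t * ((1 - 1 / t) * f x + 1 / t * f (x + t * s)) = (t - 1) * f x + f (x + t * s) := by
      field_simp
    rw [e2] at h2
    linarith
  set K : ℝ := |f (x + 1) - f x| + |f (x - 1) - f x| with hK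
  have hK0 : 0 ≤ K := by positivity
  have low : ∀ y : ℝ, 1 ≤ |y - x| → f x - |y - x| * K ≤ f y := by
    intro y hy
    have b1 := neg_abs_le (f (x + 1) - f x)
    have b2 := neg_abs_le (f (x - 1) - f x)
    have a1 := abs_nonneg (f (x + 1) - f x)
    have a2 := abs_nonneg (f (x - 1) - f x)
    have h0 : 0 ≤ |y - x| := abs_nonneg _
    rcases le_total 0 (y - x) with h | h
    · have := key 1 (by simp) _ hy
      rw [abs_of_nonneg h] at *
      rw [show x + (y - x) * 1 = y by ring] at this
      nlinarith
    · have := key (-1) (by simp) _ hy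
      rw [abs_of_nonpos h] at *
      rw [show x + -(y - x) * -1 = y by ring, show x + -1 = x - 1 by ring] at this
      nlinarith
  set r : ℝ := 2 * K / c + 1 with hr
  have hr1 : 1 ≤ r := by
    have : 0 ≤ 2 * K / c := by positivity
    linarith
  obtain ⟨y, -, hy⟩ := (isCompact_closedBall x r).exists_isMinOn
    (f := fun y => f y + c / 2 * (y - x) ^ 2) ⟨x, by simp; linarith⟩
    (Continuous.continuousOn (by fun_prop))
  refine ⟨y, fun z => ?_⟩
  rcases le_or_gt |z - x| r with hz | hz
  · exact hy (by simpa [Real.dist_eq] using hz)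
  · have h1 := hy (show x ∈ Metric.closedBall x r by simp; linarith)
    simp only [Set.mem_ofPred_eq, sub_self] at h1
    have h2 := low z (by linarith)
    have h3 : K ≤ c / 2 * |z - x| := by
      have : 2 * K / c ≤ |z - x| := by linarith
      rw [div_le_iff₀ hc] at this
      linarith
    have h4 : |z - x| * K ≤ |z - x| * (c / 2 * |z - x|) :=
      mul_le_mul_of_nonneg_left h3 (abs_nonneg _)
    have h5 : |z - x| * (c / 2 * |z - x|) = c / 2 * (z - x) ^ 2 := by
      rw [← sq_abs (z - x)]; ring
    linarith

theorem prox_spec {f : ℝ → ℝ} (hf : ConvexOn ℝ Set.univ f) {c : ℝ} (hc : 0 < c) (x : ℝ) :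
    IsProx f c x (prox f c x) :=
  Classical.epsilon_spec (exists_isProx hf hc x)

theorem IsProx.unique {f : ℝ → ℝ} (hf : ConvexOn ℝ Set.univ f) {c : ℝ} (hc : 0 < c) {x y z : ℝ}
    (hy : IsProx f c x y) (hz : IsProx f c x z) : y = z := by
  by_contra hne
  have h := hf.2 (Set.mem_univ y) (Set.mem_univ z) (show (0 : ℝ) ≤ 1 / 2 by norm_num)
    (show (0 : ℝ) ≤ 1 / 2 by norm_num) (by norm_num)
  simp only [smul_eq_mul] at h
  have h1 := hy (1 / 2 * y + 1 / 2 * z)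
  have h2 := hz (1 / 2 * y + 1 / 2 * z)
  have h3 : 0 < c * (y - z) ^ 2 := mul_pos hc (by have := sub_ne_zero.mpr hne; positivity)
  nlinarith

end

end TVConsensus

/-! Give every ordered pair of neighbours a copy `z(v,w)` of `x(w)`. The regularized problem becomes
`min F(x) + H(z)` subject to `z = A x`, with `H` the edge penalty and `(A x)(v,w) = x(w)`. The
distributed algorithm is ADMM for this splitting, with `η_n = (ρ/2) μ_{n+1}`. Antisymmetry of `μ`
makes the two multipliers on an edge opposite, so the `z`-step decouples into edges and is soft
thresholding of a difference; its residual is the projection that updates `μ` (`edge_update_le`).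
The `x`-step decouples into vertices, each a prox (`local_update_le`).

Convergence is the classical Lyapunov argument. Hahn–Banach gives a saddle point
(`exists_multiplier`), and the squared distance of `(η, ρ z)` to any saddle point decreases by at
least the squared residuals (`lyapunov_succ_le`). Hence the iterates are bounded, a cluster point is
again a saddle point, and the Lyapunov function centred there tends to zero. Injectivity of `A`
transfers convergence from `z` to `x`.

For the average, sum the explicit quadratic prox over the vertices: the antisymmetric `μ` terms
cancel when all degrees agree. -/

namespace TVConsensus

open scoped RealInnerProductSpace

/-! ### Convergence of ADMM for a general linear constraint -/

section Abstract

variable {X Z : Type*} [NormedAddCommGroup X] [NormedSpace ℝ X]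
  [NormedAddCommGroup Z] [InnerProductSpace ℝ Z]

/-- First-order optimality condition for a convex function plus a quadratic one. -/
theorem le_add_inner_of_forall_le {Y : Type*} [AddCommGroup Y] [Module ℝ Y] {φ : Y → ℝ}
    (hφ : ConvexOn ℝ Set.univ φ) (B : Y →ₗ[ℝ] Z) {b η : Z} {ρ : ℝ} (hρ : 0 < ρ) {y₀ : Y}
    (h : ∀ y, φ y₀ + (⟪η, B y₀ - b⟫ + ρ / 2 * ‖B y₀ - b‖ ^ 2)
      ≤ φ y + (⟪η, B y - b⟫ + ρ / 2 * ‖B y - b‖ ^ 2)) (y : Y) :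
    φ y₀ ≤ φ y + ⟪η + ρ • (B y₀ - b), B y - B y₀⟫ := by
  set d := B y - B y₀ with hd
  set K : ℝ := φ y₀ - φ y - ⟪η + ρ • (B y₀ - b), d⟫ with hK
  set C : ℝ := ρ / 2 * ‖d‖ ^ 2 with hC
  have hC0 : 0 ≤ C := by positivity
  -- Compare `y₀` with the point a fraction `t` of the way to `y` and divide by `t`; only the
  -- quadratic remainder keeps a factor `t`.
  have key : ∀ t : ℝ, 0 < t → t ≤ 1 → K ≤ t * C := by
    intro t ht0 ht1
    have h1 := h ((1 - t) • y₀ + t • y)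
    have h2 := hφ.2 (Set.mem_univ y₀) (Set.mem_univ y) (sub_nonneg.2 ht1) ht0.le (by ring)
    have e : B ((1 - t) • y₀ + t • y) - b = (B y₀ - b) + t • d := by
      simp only [hd, map_add, map_smul]; module
    rw [e, norm_add_sq_real, inner_add_right, inner_smul_right, inner_smul_right, norm_smul,
      mul_pow, Real.norm_eq_abs, sq_abs] at h1
    simp only [smul_eq_mul] at h2
    rw [hK, inner_add_left, inner_smul_left]
    simp only [conj_trivial]
    refine le_of_mul_le_mul_left ?_ ht0
    rw [hC]
    linarith
  by_contra hlt
  have hK0 : 0 < K := by rw [hK]; linarith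
  have hKC : 0 < 2 * (K + C) := by linarith
  -- This `t` gives `t * C ≤ K / 2`, contradicting `0 < K ≤ t * C`.
  have h1 := key (K / (2 * (K + C))) (by positivity) (by rw [div_le_one hKC]; linarith)
  rw [div_mul_eq_mul_div, le_div_iff₀ hKC] at h1
  nlinarith

/-- Existence of a Lagrange multiplier for the constraint `z = A x`. -/
theorem exists_multiplier [CompleteSpace Z] {F : X → ℝ} {H : Z → ℝ}
    (hF : ConvexOn ℝ Set.univ F) (hH : ConvexOn ℝ Set.univ H) (hHc : Continuous H)
    (A : X →ₗ[ℝ] Z) {m : ℝ} (hm : ∀ x, m ≤ F x + H (A x)) :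
    ∃ η : Z, ∀ x z, m ≤ F x + H z + ⟪η, z - A x⟫ := by
  -- The strict epigraph of the perturbed value `u ↦ inf_x F x + H (A x + u)`. It is open because
  -- `H` is continuous; `F` needs no continuity.
  set S : Set (Z × ℝ) := {p | ∃ x, F x + H (A x + p.1) < p.2} with hS
  have hopen : IsOpen S := by
    have : S = ⋃ x, {p : Z × ℝ | F x + H (A x + p.1) < p.2} := by ext; simp [hS]
    rw [this]
    exact isOpen_iUnion fun x => isOpen_lt (by fun_prop) (by fun_prop)
  have hconv : Convex ℝ S := by
    rintro ⟨u, r⟩ ⟨x, hx⟩ ⟨u', r'⟩ ⟨x', hx'⟩ a b ha hb hab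
    refine ⟨a • x + b • x', ?_⟩
    have h1 := hF.2 (Set.mem_univ x) (Set.mem_univ x') ha hb hab
    have h2 := hH.2 (Set.mem_univ (A x + u)) (Set.mem_univ (A x' + u')) ha hb hab
    have e : A (a • x + b • x') + (a • u + b • u') = a • (A x + u) + b • (A x' + u') := by
      simp only [map_add, map_smul]; module
    simp only [Prod.smul_mk, Prod.mk_add_mk, smul_eq_mul, e] at hx hx' h1 h2 ⊢
    -- Strictness is taken from the first point, whose weight may vanish.
    rcases ha.eq_or_lt with rfl | ha'
    · obtain rfl : b = 1 := by linarith
      linarith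
    · have := mul_lt_mul_of_pos_left hx ha'
      have := mul_le_mul_of_nonneg_left hx'.le hb
      linarith
  have hnot : ((0 : Z), m) ∉ S := by
    rintro ⟨x, hx⟩
    simp only [add_zero] at hx
    exact absurd (hm x) (not_le.2 hx)
  obtain ⟨ψ, hψ⟩ := geometric_hahn_banach_open_point hconv hopen hnot
  set κ : ℝ := ψ (0, 1) with hκ
  set ℓ : Z →L[ℝ] ℝ := ψ.comp (ContinuousLinearMap.inl ℝ Z ℝ) with hℓ
  have hdec : ∀ u r, ψ (u, r) = ℓ u + κ * r := by
    intro u r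
    have : ((u, r) : Z × ℝ) = (u, 0) + r • ((0 : Z), (1 : ℝ)) := by simp
    rw [this, map_add, map_smul, smul_eq_mul, mul_comm, hκ, hℓ]
    simp
  -- The separating hyperplane is not vertical: `S` contains points directly above `(0, m)`.
  have hκneg : κ < 0 := by
    have h1 := hψ (0, F 0 + H (A 0) + 1 + |m|) ⟨0, by
      simp only [add_zero]; have := abs_nonneg m; linarith⟩
    rw [hdec, hdec] at h1
    have h2 := hm 0
    have h3 := abs_nonneg m
    by_contra hc
    nlinarith
  -- Dividing the separation inequality by `-κ` makes the coefficient of the value `-1`; the Riesz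
  -- representative of what remains is the multiplier, up to sign.
  refine ⟨(-κ)⁻¹ • -((InnerProductSpace.toDual ℝ Z).symm ℓ), fun x z => ?_⟩
  rw [inner_smul_left, inner_neg_left, InnerProductSpace.toDual_symm_apply]
  simp only [conj_trivial]
  have hle : ∀ ε : ℝ, 0 < ε → ℓ (z - A x) + κ * (F x + H z + ε) ≤ κ * m := by
    intro ε hε
    have h1 := hψ (z - A x, F x + H z + ε) ⟨x, by simpa using hε⟩
    rw [hdec, hdec] at h1
    simpa using h1.le
  have hle0 : ℓ (z - A x) + κ * (F x + H z) ≤ κ * m := by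
    refine le_of_forall_pos_le_add fun ε hε => ?_
    have h1 := hle (ε / (-κ)) (div_pos hε (by linarith))
    have h2 : κ * (ε / (-κ)) = -ε := by
      rw [div_neg, mul_neg, mul_div_cancel₀ _ hκneg.ne]
    rw [mul_add, h2] at h1
    linarith
  have hκ' : 0 < -κ := by linarith
  refine le_of_mul_le_mul_left ?_ hκ'
  rw [mul_add, ← mul_assoc, mul_inv_cancel₀ hκ'.ne']
  linarith

/-- The alternating direction method of multipliers for `min F(x) + H(z)` subject to
`z = A x`. -/
structure IsAbstractADMM (F : X → ℝ) (H : Z → ℝ) (A : X →ₗ[ℝ] Z) (ρ : ℝ)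
    (x : ℕ → X) (z η : ℕ → Z) : Prop where
  x_update : ∀ n y, F (x (n + 1)) + (⟪η n, z n - A (x (n + 1))⟫
      + ρ / 2 * ‖z n - A (x (n + 1))‖ ^ 2)
    ≤ F y + (⟪η n, z n - A y⟫ + ρ / 2 * ‖z n - A y‖ ^ 2)
  z_update : ∀ n y, H (z (n + 1)) + (⟪η n, z (n + 1) - A (x (n + 1))⟫
      + ρ / 2 * ‖z (n + 1) - A (x (n + 1))‖ ^ 2)
    ≤ H y + (⟪η n, y - A (x (n + 1))⟫ + ρ / 2 * ‖y - A (x (n + 1))‖ ^ 2)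
  eta_update : ∀ n, η (n + 1) = η n + ρ • (z (n + 1) - A (x (n + 1)))

namespace IsAbstractADMM

variable {F : X → ℝ} {H : Z → ℝ} {A : X →ₗ[ℝ] Z} {ρ : ℝ} {x : ℕ → X} {z η : ℕ → Z}

/-- The `x`-step sees the old `z n`, so in terms of the new multiplier its optimality condition
carries the correction `ρ • (z n - z (n + 1))`. -/
theorem x_optimality (h : IsAbstractADMM F H A ρ x z η) (hρ : 0 < ρ)
    (hF : ConvexOn ℝ Set.univ F) (n : ℕ) (y : X) :
    F (x (n + 1)) ≤ F y
      - ⟪η (n + 1) + ρ • (z n - z (n + 1)), A y - A (x (n + 1))⟫ := by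
  have h1 := le_add_inner_of_forall_le hF (-A) (b := -z n) (η := η n) hρ (y₀ := x (n + 1))
    (fun y => by
      have e : ∀ y, (-A) y - -z n = z n - A y := fun y => by
        simp only [LinearMap.neg_apply]; abel
      rw [e, e]
      exact h.x_update n y) y
  have e1 : η n + ρ • ((-A) (x (n + 1)) - -z n) = η (n + 1) + ρ • (z n - z (n + 1)) := by
    rw [h.eta_update n]; simp only [LinearMap.neg_apply]; module
  have e2 : (-A) y - (-A) (x (n + 1)) = -(A y - A (x (n + 1))) := by
    simp only [LinearMap.neg_apply]; abel
  rwa [e1, e2, inner_neg_right, ← sub_eq_add_neg] at h1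

theorem z_optimality (h : IsAbstractADMM F H A ρ x z η) (hρ : 0 < ρ)
    (hH : ConvexOn ℝ Set.univ H) (n : ℕ) (y : Z) :
    H (z (n + 1)) ≤ H y + ⟪η (n + 1), y - z (n + 1)⟫ := by
  have h1 := le_add_inner_of_forall_le hH LinearMap.id (b := A (x (n + 1))) (η := η n) hρ
    (y₀ := z (n + 1)) (h.z_update n) y
  rwa [LinearMap.id_apply, LinearMap.id_apply, ← h.eta_update n] at h1

/-- The Lyapunov function of ADMM. -/
noncomputable def lyapunov {Z : Type*} [NormedAddCommGroup Z] (ρ : ℝ) (z η : ℕ → Z) (zs ηs : Z) (n : ℕ) : ℝ :=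
  ‖η n - ηs‖ ^ 2 + ρ ^ 2 * ‖z n - zs‖ ^ 2

theorem lyapunov_nonneg {Z : Type*} [NormedAddCommGroup Z] {z η : ℕ → Z} (zs ηs : Z) (n : ℕ) : 0 ≤ lyapunov ρ z η zs ηs n := by
  unfold lyapunov; positivity

/-- Combine the optimality conditions at the saddle point with monotonicity of the subdifferential
of `H` between consecutive `z`. The latter needs `z`-optimality at both times, hence the start at
index 1: the initial `z 0`, `η 0` satisfy no such condition. -/
theorem lyapunov_succ_le (h : IsAbstractADMM F H A ρ x z η) (hρ : 0 < ρ)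
    (hF : ConvexOn ℝ Set.univ F) (hH : ConvexOn ℝ Set.univ H) {xs : X} {ηs : Z}
    (hs : ∀ x z, F xs + H (A xs) ≤ F x + H z + ⟪ηs, z - A x⟫) (n : ℕ) :
    lyapunov ρ z η (A xs) ηs (n + 2) + ρ ^ 2 * ‖z (n + 2) - A (x (n + 2))‖ ^ 2
        + ρ ^ 2 * ‖z (n + 2) - z (n + 1)‖ ^ 2 ≤ lyapunov ρ z η (A xs) ηs (n + 1) := by
  have h1 := h.x_optimality hρ hF (n + 1) xs
  have h2 := h.z_optimality hρ hH (n + 1) (A xs)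
  have h3 := hs (x (n + 2)) (z (n + 2))
  have h4 := h.z_optimality hρ hH (n + 1) (z (n + 1))
  have h5 := h.z_optimality hρ hH n (z (n + 2))
  have h6 := h.eta_update (n + 1)
  simp only [add_assoc, Nat.reduceAdd] at h1 h2 h3 h4 h5 h6
  set r := z (n + 2) - A (x (n + 2)) with hr
  set s := z (n + 2) - z (n + 1) with hsdef
  set e := η (n + 2) - ηs with he
  set w := z (n + 2) - A xs with hw
  have ee : η (n + 1) - ηs = e - ρ • r := by rw [he, h6]; abel
  have ew : z (n + 1) - A xs = w - s := by rw [hw, hsdef]; abel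
  have e1 : A xs - A (x (n + 2)) = r - w := by rw [hr, hw]; abel
  have e2 : A xs - z (n + 2) = -w := by rw [hw]; abel
  have e3 : z (n + 1) - z (n + 2) = -s := by rw [hsdef]; abel
  have e4 : η (n + 2) = e + ηs := by rw [he]; abel
  have e5 : η (n + 1) = e + ηs - ρ • r := by rw [he, h6]; abel
  rw [e1, e3, e4] at h1
  rw [e2, e4] at h2
  rw [e3, e4] at h4
  rw [e5] at h5
  simp only [inner_add_left, inner_sub_left, inner_sub_right, inner_neg_right, inner_neg_left,
    inner_smul_left, smul_neg, conj_trivial] at h1 h2 h3 h4 h5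
  unfold lyapunov
  rw [ee, ew, norm_sub_sq_real e, norm_sub_sq_real w, inner_smul_right, norm_smul, mul_pow,
    Real.norm_eq_abs, sq_abs, real_inner_comm s w]
  -- Monotonicity: `h4 + h5`, where the multiplier increment is `ρ • r`.
  have k1 : 0 ≤ -(ρ * ⟪r, s⟫) := by linarith
  -- The sum `h1 + h2 + h3`, in which all values of `F` and `H` cancel.
  have k2 : ρ * ⟪s, w⟫ - ρ * ⟪s, r⟫ + ⟪e, r⟫ ≤ 0 := by linarith
  have k3 : ⟪s, r⟫ = ⟪r, s⟫ := real_inner_comm _ _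
  nlinarith [mul_nonneg hρ.le k1, mul_le_mul_of_nonneg_left k2 hρ.le]

theorem lyapunov_antitone (h : IsAbstractADMM F H A ρ x z η) (hρ : 0 < ρ)
    (hF : ConvexOn ℝ Set.univ F) (hH : ConvexOn ℝ Set.univ H) {xs : X} {ηs : Z}
    (hs : ∀ x z, F xs + H (A xs) ≤ F x + H z + ⟪ηs, z - A x⟫) :
    Antitone fun n => lyapunov ρ z η (A xs) ηs (n + 1) :=
  antitone_nat_of_succ_le fun n => by
    have h1 := h.lyapunov_succ_le hρ hF hH hs n
    have h2 : 0 ≤ ρ ^ 2 * ‖z (n + 2) - A (x (n + 2))‖ ^ 2 := by positivity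
    have h3 : 0 ≤ ρ ^ 2 * ‖z (n + 2) - z (n + 1)‖ ^ 2 := by positivity
    simp only [add_assoc, Nat.reduceAdd]
    linarith

/-- The decrements of a convergent sequence tend to zero, and they dominate both squared residuals.
-/
theorem tendsto_residuals (h : IsAbstractADMM F H A ρ x z η) (hρ : 0 < ρ)
    (hF : ConvexOn ℝ Set.univ F) (hH : ConvexOn ℝ Set.univ H) {xs : X} {ηs : Z}
    (hs : ∀ x z, F xs + H (A xs) ≤ F x + H z + ⟪ηs, z - A x⟫) :
    Tendsto (fun n => z (n + 2) - A (x (n + 2))) atTop (𝓝 0) ∧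
      Tendsto (fun n => z (n + 2) - z (n + 1)) atTop (𝓝 0) := by
  set L := fun n => lyapunov ρ z η (A xs) ηs (n + 1) with hL
  have hstep := h.lyapunov_succ_le hρ hF hH hs
  have hanti : Antitone L := h.lyapunov_antitone hρ hF hH hs
  have hbdd : BddBelow (Set.range L) :=
    ⟨0, by rintro _ ⟨n, rfl⟩; exact lyapunov_nonneg _ _ _⟩
  have hlim := tendsto_atTop_ciInf hanti hbdd
  have hdiff : Tendsto (fun n => (L n - L (n + 1)) / ρ ^ 2) atTop (𝓝 0) := by
    simpa using (hlim.sub (hlim.comp (tendsto_add_atTop_nat 1))).div_const (ρ ^ 2)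
  have conclude : ∀ a : ℕ → Z, (∀ n, ρ ^ 2 * ‖a n‖ ^ 2 ≤ L n - L (n + 1)) →
      Tendsto a atTop (𝓝 0) := by
    intro a ha
    rw [tendsto_zero_iff_norm_tendsto_zero]
    have hsq : Tendsto (fun n => ‖a n‖ ^ 2) atTop (𝓝 0) := by
      refine squeeze_zero (fun n => by positivity) (fun n => ?_) hdiff
      rw [le_div_iff₀ (by positivity), mul_comm]
      exact ha n
    simpa using hsq.sqrt
  constructor
  all_goals
    refine conclude _ fun n => ?_
    have h1 := hstep n
    have h2 : 0 ≤ ρ ^ 2 * ‖z (n + 2) - A (x (n + 2))‖ ^ 2 := by positivity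
    have h3 : 0 ≤ ρ ^ 2 * ‖z (n + 2) - z (n + 1)‖ ^ 2 := by positivity
    simp only [hL, add_assoc, Nat.reduceAdd]
    linarith

variable [FiniteDimensional ℝ X] [FiniteDimensional ℝ Z]

/-- Convergence of ADMM in finite dimension. -/
theorem exists_tendsto (h : IsAbstractADMM F H A ρ x z η) (hρ : 0 < ρ)
    (hF : ConvexOn ℝ Set.univ F) (hH : ConvexOn ℝ Set.univ H) (hA : Function.Injective A)
    (hmin : ∃ xs, ∀ y, F xs + H (A xs) ≤ F y + H (A y)) :
    ∃ xs, (∀ y, F xs + H (A xs) ≤ F y + H (A y)) ∧ Tendsto x atTop (𝓝 xs) := by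
  have hFc : Continuous F := continuousOn_univ.1 (hF.continuousOn isOpen_univ)
  have hHc : Continuous H := continuousOn_univ.1 (hH.continuousOn isOpen_univ)
  have hAc : Continuous A := A.continuous_of_finiteDimensional
  have hAe : Topology.IsClosedEmbedding A :=
    LinearMap.isClosedEmbedding_of_injective (LinearMap.ker_eq_bot.2 hA)
  have : CompleteSpace Z := FiniteDimensional.complete ℝ Z
  obtain ⟨x₀, hx₀⟩ := hmin
  obtain ⟨η₀, hη₀⟩ := exists_multiplier hF hH hHc A hx₀
  obtain ⟨hr, hsuc⟩ := h.tendsto_residuals hρ hF hH hη₀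
  have hbound : ∀ n, lyapunov ρ z η (A x₀) η₀ (n + 1) ≤ lyapunov ρ z η (A x₀) η₀ 1 :=
    fun n => h.lyapunov_antitone hρ hF hH hη₀ (Nat.zero_le n)
  set M := lyapunov ρ z η (A x₀) η₀ 1
  have hηb : ∀ n, η (n + 2) ∈ Metric.closedBall η₀ (√M) := fun n => by
    rw [mem_closedBall_iff_norm]
    refine Real.le_sqrt_of_sq_le (le_trans ?_ (hbound (n + 1)))
    unfold lyapunov
    have : 0 ≤ ρ ^ 2 * ‖z (n + 2) - A x₀‖ ^ 2 := by positivity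
    simp only [add_assoc, Nat.reduceAdd]
    linarith
  have hzb : ∀ n, z (n + 2) ∈ Metric.closedBall (A x₀) (√(M / ρ ^ 2)) := fun n => by
    rw [mem_closedBall_iff_norm]
    refine Real.le_sqrt_of_sq_le ?_
    rw [le_div_iff₀ (by positivity), mul_comm]
    refine le_trans ?_ (hbound (n + 1))
    unfold lyapunov
    have : 0 ≤ ‖η (n + 2) - η₀‖ ^ 2 := by positivity
    simp only [add_assoc, Nat.reduceAdd]
    linarith
  obtain ⟨⟨zs, ηs⟩, -, k, hk, hlim⟩ := ((isCompact_closedBall (A x₀) (√(M / ρ ^ 2))).prod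
    (isCompact_closedBall η₀ (√M))).tendsto_subseq
    (x := fun n => (z (n + 2), η (n + 2))) fun n => ⟨hzb n, hηb n⟩
  have hz : Tendsto (fun n => z (k n + 2)) atTop (𝓝 zs) :=
    (continuous_fst.tendsto _).comp hlim
  have hη : Tendsto (fun n => η (k n + 2)) atTop (𝓝 ηs) :=
    (continuous_snd.tendsto _).comp hlim
  have hAx : Tendsto (fun n => A (x (k n + 2))) atTop (𝓝 zs) := by
    simpa using hz.sub (hr.comp hk.tendsto_atTop)
  obtain ⟨xs, rfl⟩ : zs ∈ Set.range A :=
    hAe.isClosed_range.mem_of_tendsto hAx (Eventually.of_forall fun n => ⟨_, rfl⟩)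
  have hx : Tendsto (fun n => x (k n + 2)) atTop (𝓝 xs) :=
    hAe.isInducing.tendsto_nhds_iff.2 hAx
  have hs' : Tendsto (fun n => z (k n + 1) - z (k n + 2)) atTop (𝓝 0) := by
    simpa using (hsuc.comp hk.tendsto_atTop).neg
  -- Pass to the limit in the optimality conditions; the correction term vanishes with `z n - z (n +
  -- 1)`.
  have hFopt : ∀ y, F xs ≤ F y - ⟪ηs, A y - A xs⟫ := fun y => by
    have hl := (hFc.tendsto xs).comp hx
    have hrgt : Tendsto (fun n => F y - ⟪η (k n + 2) + ρ • (z (k n + 1) - z (k n + 2)),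
        A y - A (x (k n + 2))⟫) atTop (𝓝 (F y - ⟪ηs + ρ • (0 : Z), A y - A xs⟫)) :=
      tendsto_const_nhds.sub ((hη.add (hs'.const_smul ρ)).inner (tendsto_const_nhds.sub hAx))
    rw [smul_zero, add_zero] at hrgt
    exact le_of_tendsto_of_tendsto' hl hrgt fun n => h.x_optimality hρ hF (k n + 1) y
  have hHopt : ∀ y, H (A xs) ≤ H y + ⟪ηs, y - A xs⟫ := fun y =>
    le_of_tendsto_of_tendsto' ((hHc.tendsto _).comp hz)
      (tendsto_const_nhds.add (hη.inner (tendsto_const_nhds.sub hz)))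
      fun n => h.z_optimality hρ hH (k n + 1) y
  have hsaddle : ∀ y w, F xs + H (A xs) ≤ F y + H w + ⟪ηs, w - A y⟫ := fun y w => by
    have h1 := hFopt y
    have h2 := hHopt w
    simp only [inner_sub_right] at h1 h2 ⊢
    linarith
  refine ⟨xs, fun y => by simpa using hsaddle y (A y), ?_⟩
  -- Recentre the Lyapunov function at the cluster point: it is monotone and tends to zero along the
  -- subsequence, hence along the whole sequence.
  have hanti := h.lyapunov_antitone hρ hF hH hsaddle
  have hLlim := tendsto_atTop_ciInf hanti
    ⟨0, by rintro _ ⟨n, rfl⟩; exact lyapunov_nonneg _ _ _⟩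
  have hLsub : Tendsto (fun n => lyapunov ρ z η (A xs) ηs (k n + 2)) atTop (𝓝 0) := by
    have := ((hη.sub_const ηs).norm.pow 2).add (((hz.sub_const (A xs)).norm.pow 2).const_mul
      (ρ ^ 2))
    simpa [lyapunov] using this
  have hL0 : Tendsto (fun n => lyapunov ρ z η (A xs) ηs (n + 1)) atTop (𝓝 0) := by
    have hk1 : Tendsto (fun n => k n + 1) atTop atTop :=
      (tendsto_add_atTop_nat 1).comp hk.tendsto_atTop
    have := tendsto_nhds_unique (hLlim.comp hk1) hLsub
    rwa [this] at hLlim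
  have hzlim : Tendsto (fun n => z (n + 2)) atTop (𝓝 (A xs)) := by
    rw [tendsto_iff_norm_sub_tendsto_zero]
    have hsq : Tendsto (fun n => ‖z (n + 2) - A xs‖ ^ 2) atTop (𝓝 0) := by
      refine squeeze_zero (fun n => by positivity) (fun n => ?_)
        (by simpa using (hL0.comp (tendsto_add_atTop_nat 1)).div_const (ρ ^ 2))
      rw [le_div_iff₀ (by positivity), mul_comm]
      unfold lyapunov
      have : 0 ≤ ‖η (n + 2) - ηs‖ ^ 2 := by positivity
      simp only [add_assoc, Nat.reduceAdd]
      linarith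
    simpa using hsq.sqrt
  have hAxlim : Tendsto (fun n => A (x (n + 2))) atTop (𝓝 (A xs)) := by
    simpa using hzlim.sub hr
  exact (tendsto_add_atTop_iff_nat 2).1 (hAe.isInducing.tendsto_nhds_iff.2 hAxlim)

end IsAbstractADMM

end Abstract

/-! ### Projection onto an interval and the update on one edge -/

section Projection

variable {ω : ℝ}

theorem projInterval_neg (hω : 0 ≤ ω) (t : ℝ) : projInterval ω (-t) = -projInterval ω t := by
  unfold projInterval
  rcases le_total ω t with h | h <;> rcases le_total (-ω) t with h' | h' <;>
    simp only [min_def, max_def] <;> split_ifs <;> linarith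

theorem abs_projInterval_le (hω : 0 ≤ ω) (t : ℝ) : |projInterval ω t| ≤ ω := by
  rw [abs_le]
  exact ⟨le_max_left _ _, max_le (by linarith) (min_le_left _ _)⟩

/-- Complementary slackness: a nonzero residual occurs only when the projection is an endpoint, and
then has the opposite sign. -/
theorem mul_abs_projInterval_sub (hω : 0 ≤ ω) (t : ℝ) :
    ω * |projInterval ω t - t| = -(projInterval ω t * (projInterval ω t - t)) := by
  unfold projInterval
  rcases le_total ω t with h | h
  · rw [min_eq_left h, max_eq_right (by linarith), abs_of_nonpos (by linarith)]; ring
  · rw [min_eq_right h]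
    rcases le_total (-ω) t with h' | h'
    · rw [max_eq_right h']; simp
    · rw [max_eq_left h', abs_of_nonneg (by linarith)]; ring

/-- The explicit minimizer of the part of the augmented Lagrangian that belongs to one edge. -/
theorem edge_update_le {lam ρ : ℝ} (hlam : 0 < lam) (hρ : 0 < ρ) (m p q a' b' : ℝ) :
    let ν := projInterval (2 * lam / ρ) (m + q - p)
    let a := p + 1 / 2 * (ν - m)
    let b := q - 1 / 2 * (ν - m)
    lam * |a - b| + ((ρ / 2 * m * (a - p) + ρ / 2 * (a - p) ^ 2)
        + (-(ρ / 2 * m) * (b - q) + ρ / 2 * (b - q) ^ 2))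
      ≤ lam * |a' - b'| + ((ρ / 2 * m * (a' - p) + ρ / 2 * (a' - p) ^ 2)
        + (-(ρ / 2 * m) * (b' - q) + ρ / 2 * (b' - q) ^ 2)) := by
  intro ν a b
  have hω : 0 ≤ 2 * lam / ρ := by positivity
  have h1 := abs_projInterval_le hω (m + q - p)
  have h2 := mul_abs_projInterval_sub hω (m + q - p)
  change |ν| ≤ _ at h1
  change _ * |ν - _| = -(ν * (ν - _)) at h2
  have e : ν - (m + q - p) = a - b := by simp only [a, b]; ring
  rw [e] at h2
  have hl : ρ / 2 * (2 * lam / ρ) = lam := by field_simp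
  have h3 : lam * |a - b| = -(ρ / 2 * ν * (a - b)) := by
    rw [← hl, mul_assoc, h2]; ring
  have h4 : |ρ / 2 * ν| ≤ lam := by
    rw [abs_mul, abs_of_pos (by positivity : 0 < ρ / 2), ← hl]
    exact mul_le_mul_of_nonneg_left h1 (by positivity)
  -- With equality at `a - b` by `h3`, this says that `-(ρ / 2) * ν` is a subgradient of `lam * |·|`
  -- there.
  have h5 : -(ρ / 2 * ν * (a' - b')) ≤ lam * |a' - b'| := by
    refine (neg_le_abs _).trans ?_
    rw [abs_mul]
    exact mul_le_mul_of_nonneg_right h4 (abs_nonneg _)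
  have h6 : 0 ≤ ρ / 2 * ((a' - a) ^ 2 + (b' - b) ^ 2) := by positivity
  have h7 : ((ρ / 2 * m * (a' - p) + ρ / 2 * (a' - p) ^ 2)
        + (-(ρ / 2 * m) * (b' - q) + ρ / 2 * (b' - q) ^ 2))
      - ((ρ / 2 * m * (a - p) + ρ / 2 * (a - p) ^ 2)
        + (-(ρ / 2 * m) * (b - q) + ρ / 2 * (b - q) ^ 2))
      = ρ / 2 * ((a' - a) ^ 2 + (b' - b) ^ 2)
        + (ρ / 2 * ν * (a' - b') - ρ / 2 * ν * (a - b)) := by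
    simp only [a, b]; ring
  linarith

end Projection

/-! ### Sums over edges and ordered adjacent pairs -/

section Graph

variable {V : Type*} [Fintype V] {G : SimpleGraph V} [DecidableRel G.Adj]

theorem convexOn_sum_apply {f : V → ℝ → ℝ} (hf : ∀ v, ConvexOn ℝ Set.univ (f v)) :
    ConvexOn ℝ Set.univ fun x : V → ℝ => ∑ v, f v (x v) := by
  refine ⟨convex_univ, fun x _ y _ a b ha hb hab => ?_⟩
  simp only [smul_eq_mul]
  rw [Finset.mul_sum, Finset.mul_sum, ← Finset.sum_add_distrib]
  exact Finset.sum_le_sum fun v _ =>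
    (hf v).2 (Set.mem_univ (x v)) (Set.mem_univ (y v)) ha hb hab

theorem sum_neighborFinset_swap (g : V → V → ℝ) :
    ∑ v, ∑ w ∈ G.neighborFinset v, g v w = ∑ v, ∑ w ∈ G.neighborFinset v, g w v :=
  Finset.sum_comm' fun v w => by simp [G.adj_comm]

theorem sum_neighborFinset_eq_zero {μ : V → V → ℝ}
    (hμ : ∀ v w, G.Adj v w → μ w v = -μ v w) :
    ∑ v, ∑ w ∈ G.neighborFinset v, μ w v = 0 := by
  have h : ∑ v, ∑ w ∈ G.neighborFinset v, μ w v
      = -∑ v, ∑ w ∈ G.neighborFinset v, μ w v := by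
    conv_lhs => rw [← sum_neighborFinset_swap fun v w => μ v w]
    rw [← Finset.sum_neg_distrib]
    refine Finset.sum_congr rfl fun v _ => ?_
    rw [← Finset.sum_neg_distrib]
    refine Finset.sum_congr rfl fun w hw => ?_
    rw [hμ v w (by simpa using hw), neg_neg]
  linarith

/-- The restriction of functions on pairs of vertices to ordered adjacent pairs. -/
noncomputable def restrictPairs (G : SimpleGraph V) [DecidableRel G.Adj] :
    (V → V → ℝ) →ₗ[ℝ] EuclideanSpace ℝ (Σ v : V, G.neighborFinset v) where
  toFun y := WithLp.toLp 2 fun p => y p.1 p.2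
  map_add' _ _ := by ext; simp
  map_smul' _ _ := by ext; simp

theorem restrictPairs_apply (y : V → V → ℝ) (p : Σ v : V, G.neighborFinset v) :
    restrictPairs G y p = y p.1 p.2 := rfl

/-- The constraint operator `(A x)(v, w) = x(w)`. -/
noncomputable def targetValues (G : SimpleGraph V) [DecidableRel G.Adj] :
    (V → ℝ) →ₗ[ℝ] EuclideanSpace ℝ (Σ v : V, G.neighborFinset v) where
  toFun x := restrictPairs G fun _ w => x w
  map_add' x y := (restrictPairs G).map_add (fun _ w => x w) fun _ w => y w
  map_smul' c x := (restrictPairs G).map_smul c fun _ w => x w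

theorem targetValues_apply (x : V → ℝ) :
    targetValues G x = restrictPairs G fun _ w => x w := rfl

variable [DecidableEq V]

/-- A sum over ordered adjacent pairs as a sum over edges. -/
theorem sum_neighborFinset_eq_sum_edgeFinset (g : V → V → ℝ) :
    ∑ v, ∑ w ∈ G.neighborFinset v, g v w
      = ∑ e ∈ G.edgeFinset,
          Sym2.lift ⟨fun v w => g v w + g w v, fun v w => add_comm (g v w) (g w v)⟩ e := by
  -- Group the ordered pairs by their underlying edge; each fibre consists of the two orientations.
  rw [Finset.sum_sigma', ← Finset.sum_fiberwise_of_maps_to (t := G.edgeFinset)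
    (g := fun p : Σ _ : V, V => s(p.1, p.2)) (by rintro ⟨v, w⟩ h; simpa using h)]
  refine Finset.sum_congr rfl fun e he => ?_
  induction e with
  | _ v w =>
    rw [SimpleGraph.mem_edgeFinset, SimpleGraph.mem_edgeSet] at he
    have hfib : {p ∈ Finset.univ.sigma fun v => G.neighborFinset v |
        s(p.1, p.2) = s(v, w)} = ({⟨v, w⟩, ⟨w, v⟩} : Finset (Σ _ : V, V)) := by
      ext ⟨a, b⟩
      simp only [Finset.mem_filter, Finset.mem_sigma, Finset.mem_univ, true_and,
        SimpleGraph.mem_neighborFinset, Finset.mem_insert, Finset.mem_singleton, Sym2.eq_iff,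
        Sigma.mk.injEq, heq_eq_eq]
      constructor
      · exact fun h => h.2
      · rintro (⟨rfl, rfl⟩ | ⟨rfl, rfl⟩)
        · exact ⟨he, Or.inl ⟨rfl, rfl⟩⟩
        · exact ⟨he.symm, Or.inr ⟨rfl, rfl⟩⟩
    rw [hfib, Finset.sum_pair (by
      intro h
      simp only [Sigma.mk.injEq, heq_eq_eq] at h
      exact he.ne h.1)]
    simp

/-! ### The distributed algorithm as ADMM, and preservation of the average -/

namespace IsDistributedADMM

variable {f : V → ℝ → ℝ} {lam ρ : ℝ} {x : ℕ → V → ℝ} {μ : ℕ → V → V → ℝ}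

/-- The projection is odd, so the update preserves antisymmetry. -/
theorem antisymm (h : IsDistributedADMM G f lam ρ x μ) (hlam : 0 < lam) (hρ : 0 < ρ) (n : ℕ)
    (v w : V) (hvw : G.Adj v w) : μ n w v = -μ n v w := by
  induction n with
  | zero => exact h.init_antisymm v w hvw
  | succ n ih =>
    rw [h.mu_update n v w hvw, h.mu_update n w v hvw.symm, ih,
      ← projInterval_neg (by positivity)]
    congr 1
    ring

/-- An agent's proximal step minimizes its part of the augmented Lagrangian. -/
theorem local_update_le (h : IsDistributedADMM G f lam ρ x μ) (hdeg : ∀ v, 0 < G.degree v)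
    (hconv : ∀ v, ConvexOn ℝ Set.univ (f v)) (hρ : 0 < ρ) (n : ℕ) (v : V) (y : ℝ) :
    f v (x (n + 1) v) + ∑ w ∈ G.neighborFinset v,
        (ρ / 2 * μ (n + 1) w v * (x n v + 1 / 2 * (μ (n + 1) w v - μ n w v) - x (n + 1) v)
          + ρ / 2 * (x n v + 1 / 2 * (μ (n + 1) w v - μ n w v) - x (n + 1) v) ^ 2)
      ≤ f v y + ∑ w ∈ G.neighborFinset v,
        (ρ / 2 * μ (n + 1) w v * (x n v + 1 / 2 * (μ (n + 1) w v - μ n w v) - y)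
          + ρ / 2 * (x n v + 1 / 2 * (μ (n + 1) w v - μ n w v) - y) ^ 2) := by
  have hd : (0 : ℝ) < G.degree v := by exact_mod_cast hdeg v
  have h1 := prox_spec (hconv v) (mul_pos hρ hd)
    (x n v + nbrAverage G (μ (n + 1)) v - 1 / 2 * nbrAverage G (μ n) v) y
  rw [← h.x_update n v] at h1
  set c := x n v + nbrAverage G (μ (n + 1)) v - 1 / 2 * nbrAverage G (μ n) v with hc
  set y₀ := x (n + 1) v
  have hdc : (G.degree v : ℝ) * c = G.degree v * x n v
      + ∑ w ∈ G.neighborFinset v, μ (n + 1) w v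
      - 1 / 2 * ∑ w ∈ G.neighborFinset v, μ n w v := by
    rw [hc, nbrAverage, nbrAverage]; field_simp
  -- As functions of `y`, the neighbour sum and `ρ d(v)/2 (y - c)²` differ by a constant; taking
  -- differences removes it.
  have hdiff : ∑ w ∈ G.neighborFinset v,
        (ρ / 2 * μ (n + 1) w v * (x n v + 1 / 2 * (μ (n + 1) w v - μ n w v) - y)
          + ρ / 2 * (x n v + 1 / 2 * (μ (n + 1) w v - μ n w v) - y) ^ 2)
      - ∑ w ∈ G.neighborFinset v,
        (ρ / 2 * μ (n + 1) w v * (x n v + 1 / 2 * (μ (n + 1) w v - μ n w v) - y₀)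
          + ρ / 2 * (x n v + 1 / 2 * (μ (n + 1) w v - μ n w v) - y₀) ^ 2)
      = ρ * (y₀ - y) * (G.degree v * x n v + ∑ w ∈ G.neighborFinset v, μ (n + 1) w v
          - 1 / 2 * ∑ w ∈ G.neighborFinset v, μ n w v)
        - ρ * (y₀ - y) * ((y + y₀) / 2) * G.degree v := by
    have hcard : (G.degree v : ℝ) = ∑ w ∈ G.neighborFinset v, (1 : ℝ) := by simp
    rw [hcard, Finset.sum_mul, Finset.mul_sum (a := (1 / 2 : ℝ)), ← Finset.sum_add_distrib,
      ← Finset.sum_sub_distrib, ← Finset.sum_sub_distrib, Finset.mul_sum, Finset.mul_sum,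
      ← Finset.sum_sub_distrib]
    refine Finset.sum_congr rfl fun w _ => ?_
    ring
  rw [← hdc] at hdiff
  nlinarith

/-- The choice of `z` is forced by the multiplier update once `η n = (ρ/2) μ (n + 1)`, except at
time 0, where the same formula makes the first `x`-step agree with the prox step. -/
theorem isADMM (h : IsDistributedADMM G f lam ρ x μ) (hdeg : ∀ v, 0 < G.degree v)
    (hconv : ∀ v, ConvexOn ℝ Set.univ (f v)) (hlam : 0 < lam) (hρ : 0 < ρ) :
    IsADMM G f lam ρ x (fun n v w => x n w + 1 / 2 * (μ (n + 1) v w - μ n v w))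
      (fun n v w => ρ / 2 * μ (n + 1) v w) where
  x_update n y := by
    unfold augLagrangian
    -- Collect the pairs by their second vertex, since the pair `(v,w)` involves `x w`.
    rw [sum_neighborFinset_swap, sum_neighborFinset_swap (G := G) (g := fun v w =>
      ρ / 2 * μ (n + 1) v w * (x n w + 1 / 2 * (μ (n + 1) v w - μ n v w) - y w) + _)]
    have := Finset.sum_le_sum fun v (_ : v ∈ Finset.univ) =>
      h.local_update_le hdeg hconv hρ n v (y v)
    rw [Finset.sum_add_distrib, Finset.sum_add_distrib] at this
    linarith
  z_update n y := by
    unfold augLagrangian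
    rw [sum_neighborFinset_eq_sum_edgeFinset, sum_neighborFinset_eq_sum_edgeFinset, add_assoc,
      add_assoc (∑ v, _), ← Finset.sum_add_distrib, ← Finset.sum_add_distrib]
    refine add_le_add le_rfl (Finset.sum_le_sum fun e he => ?_)
    induction e with
    | _ v w =>
      rw [SimpleGraph.mem_edgeFinset, SimpleGraph.mem_edgeSet] at he
      have h1 := edge_update_le hlam hρ (μ (n + 1) v w) (x (n + 1) w) (x (n + 1) v)
        (y v w) (y w v)
      simp only [Sym2.lift_mk]
      rw [h.antisymm hlam hρ (n + 1) v w he, h.antisymm hlam hρ (n + 1 + 1) v w he,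
        h.mu_update (n + 1) w v he.symm]
      dsimp only at h1
      rw [sub_eq_add_neg (x (n + 1) v), ← mul_neg, neg_sub', sub_neg_eq_add,
        ← sub_neg_eq_add _ (μ (n + 1) v w)] at h1
      simpa only [neg_mul, mul_neg] using h1
  eta_update n v w _ := by ring

/-- The average is preserved on regular graphs in the average consensus case. -/
theorem average_eq (h : IsDistributedADMM G f lam ρ x μ) (hdeg : ∀ v, 0 < G.degree v)
    (hconv : ∀ v, ConvexOn ℝ Set.univ (f v)) (hlam : 0 < lam) (hρ : 0 < ρ)
    (hf : ∀ v y, f v y = 1 / 2 * (y - x 0 v) ^ 2) {d : ℕ} (hreg : G.IsRegularOfDegree d)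
    (n : ℕ) : average (x n) = average (x 0) := by
  suffices hsum : ∑ v, x n v = ∑ v, x 0 v by rw [average, average, hsum]
  induction n with
  | zero => rfl
  | succ n ih =>
    rcases isEmpty_or_nonempty V with hV | ⟨⟨v₀⟩⟩
    · simp
    have hd : (0 : ℝ) < d := by exact_mod_cast hreg v₀ ▸ hdeg v₀
    have hc : 0 < ρ * d := mul_pos hρ hd
    have havg : ∀ m, ∑ v, nbrAverage G (μ m) v = 0 := fun m => by
      simp only [nbrAverage, hreg.degree_eq]
      rw [← Finset.mul_sum, sum_neighborFinset_eq_zero (h.antisymm hlam hρ m), mul_zero]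
    -- Stationarity for the quadratic prox objective.
    have hx : ∀ v, (1 + ρ * d) * x (n + 1) v = x 0 v + ρ * d * (x n v
        + nbrAverage G (μ (n + 1)) v - 1 / 2 * nbrAverage G (μ n) v) := fun v => by
      rw [h.x_update n v, hreg.degree_eq]
      set p := x n v + nbrAverage G (μ (n + 1)) v - 1 / 2 * nbrAverage G (μ n) v
      set y := (x 0 v + ρ * d * p) / (1 + ρ * d) with hy
      have hy' : (1 + ρ * d) * y = x 0 v + ρ * d * p := by rw [hy]; field_simp
      have hprox : IsProx (f v) (ρ * d) p y := fun z => by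
        rw [hf, hf]
        have hz : 0 ≤ (1 + ρ * d) / 2 * (z - y) ^ 2 := by positivity
        rw [show x 0 v = (1 + ρ * d) * y - ρ * d * p by linarith]
        linarith
      rw [(prox_spec (hconv v) hc p).unique (hconv v) hc hprox, hy']
    have hs := Finset.sum_congr (rfl : (Finset.univ : Finset V) = _) fun v _ => hx v
    rw [← Finset.mul_sum, Finset.sum_add_distrib, ← Finset.mul_sum, Finset.sum_sub_distrib,
      Finset.sum_add_distrib, ← Finset.mul_sum, havg, havg, ih] at hs
    have hpos : 0 < 1 + ρ * d := by linarith
    refine mul_left_cancel₀ hpos.ne' ?_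
    rw [hs]
    ring

end IsDistributedADMM

/-! ### Transfer to abstract ADMM on the Euclidean space of ordered adjacent pairs -/

/-- Extension by zero of functions on ordered adjacent pairs. -/
noncomputable def extendPairs (z : EuclideanSpace ℝ (Σ v : V, G.neighborFinset v)) (v w : V) :
    ℝ :=
  if h : w ∈ G.neighborFinset v then z ⟨v, w, h⟩ else 0

theorem restrictPairs_extendPairs (z : EuclideanSpace ℝ (Σ v : V, G.neighborFinset v)) :
    restrictPairs G (extendPairs z) = z := by
  ext ⟨v, w, h⟩
  exact dif_pos h

theorem extendPairs_restrictPairs (y : V → V → ℝ) {v w : V} (h : G.Adj v w) :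
    extendPairs (restrictPairs G y) v w = y v w := by
  have h' : w ∈ G.neighborFinset v := by simpa using h
  rw [extendPairs, dif_pos h', restrictPairs_apply]

theorem extendPairs_add_smul (a b : ℝ)
    (z z' : EuclideanSpace ℝ (Σ v : V, G.neighborFinset v)) (v w : V) :
    extendPairs (a • z + b • z') v w = a * extendPairs z v w + b * extendPairs z' v w := by
  unfold extendPairs
  split_ifs <;> simp

/-- The total variation penalty of the split problem. -/
noncomputable def splitPenalty (G : SimpleGraph V) [DecidableRel G.Adj] (lam : ℝ)
    (z : V → V → ℝ) : ℝ :=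
  ∑ e ∈ G.edgeFinset, Sym2.lift ⟨fun v w => lam * |z v w - z w v|,
    fun v w => congrArg (lam * ·) (abs_sub_comm (z v w) (z w v))⟩ e

/-- The penalty reads only adjacent pairs, so discarding the other values is harmless. -/
theorem splitPenalty_extendPairs_restrictPairs (lam : ℝ) (y : V → V → ℝ) :
    splitPenalty G lam (extendPairs (restrictPairs G y)) = splitPenalty G lam y := by
  refine Finset.sum_congr rfl fun e he => ?_
  induction e with
  | _ v w =>
    rw [SimpleGraph.mem_edgeFinset, SimpleGraph.mem_edgeSet] at he
    simp only [Sym2.lift_mk, extendPairs_restrictPairs y he, extendPairs_restrictPairs y he.symm]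

theorem convexOn_splitPenalty {lam : ℝ} (hlam : 0 ≤ lam) :
    ConvexOn ℝ Set.univ
      fun z : EuclideanSpace ℝ (Σ v : V, G.neighborFinset v) =>
        splitPenalty G lam (extendPairs z) := by
  refine ⟨convex_univ, fun z _ z' _ a b ha hb _ => ?_⟩
  simp only [splitPenalty, smul_eq_mul]
  rw [Finset.mul_sum, Finset.mul_sum, ← Finset.sum_add_distrib]
  refine Finset.sum_le_sum fun e _ => ?_
  induction e with
  | _ v w =>
    simp only [Sym2.lift_mk, extendPairs_add_smul]
    set p := extendPairs z v w - extendPairs z w v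
    set q := extendPairs z' v w - extendPairs z' w v
    have e1 : a * extendPairs z v w + b * extendPairs z' v w
        - (a * extendPairs z w v + b * extendPairs z' w v) = a * p + b * q := by
      simp only [p, q]; ring
    have h1 : |a * p + b * q| ≤ a * |p| + b * |q| := by
      refine (abs_add_le _ _).trans ?_
      rw [abs_mul, abs_mul, abs_of_nonneg ha, abs_of_nonneg hb]
    rw [e1]
    refine (mul_le_mul_of_nonneg_left h1 hlam).trans_eq ?_
    ring

/-- Each vertex has a neighbour, so each value `x w` is copied at least once. -/
theorem targetValues_injective (hdeg : ∀ v, 0 < G.degree v) :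
    Function.Injective (targetValues G) := by
  intro x y hxy
  funext w
  obtain ⟨v, hv⟩ := (G.degree_pos_iff_exists_adj w).1 (hdeg w)
  have := congrArg (fun z => extendPairs z v w) hxy
  simpa only [targetValues_apply, extendPairs_restrictPairs _ hv.symm] using this

theorem energy_eq (f : V → ℝ → ℝ) (lam : ℝ) (x : V → ℝ) :
    energy G f lam x
      = ∑ v, f v (x v) + splitPenalty G lam (extendPairs (targetValues G x)) := by
  rw [targetValues_apply, splitPenalty_extendPairs_restrictPairs,
    energy, tv, splitPenalty, Finset.mul_sum]
  congr 1
  refine Finset.sum_congr rfl fun e _ => ?_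
  induction e with
  | _ v w => simp only [Sym2.lift_mk]; rw [abs_sub_comm]

theorem augLagrangian_eq (f : V → ℝ → ℝ) (lam ρ : ℝ) (x : V → ℝ) (z η : V → V → ℝ) :
    augLagrangian G f lam ρ x z η
      = ∑ v, f v (x v) + splitPenalty G lam (extendPairs (restrictPairs G z))
        + (⟪restrictPairs G η, restrictPairs G z - targetValues G x⟫
          + ρ / 2 * ‖restrictPairs G z - targetValues G x‖ ^ 2) := by
  rw [splitPenalty_extendPairs_restrictPairs, augLagrangian, splitPenalty,
    EuclideanSpace.norm_sq_eq, PiLp.inner_apply, Finset.mul_sum, ← Finset.sum_add_distrib,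
    Fintype.sum_sigma]
  congr 1
  refine Finset.sum_congr rfl fun v _ => ?_
  rw [← Finset.sum_coe_sort]
  refine Finset.sum_congr rfl fun w _ => ?_
  simp only [targetValues_apply, restrictPairs_apply, PiLp.sub_apply,
    Real.norm_eq_abs, sq_abs, RCLike.inner_apply, conj_trivial]
  ring

theorem IsADMM.isAbstractADMM {f : V → ℝ → ℝ} {lam ρ : ℝ} {x : ℕ → V → ℝ}
    {z η : ℕ → V → V → ℝ} (h : IsADMM G f lam ρ x z η) :
    IsAbstractADMM (fun x : V → ℝ => ∑ v, f v (x v))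
      (fun z => splitPenalty G lam (extendPairs z)) (targetValues G) ρ x
      (fun n => restrictPairs G (z n)) (fun n => restrictPairs G (η n)) where
  x_update n y := by
    have h1 := h.x_update n y
    rw [augLagrangian_eq, augLagrangian_eq] at h1
    linarith
  z_update n y := by
    have h1 := h.z_update n (extendPairs y)
    rw [augLagrangian_eq, augLagrangian_eq, restrictPairs_extendPairs] at h1
    linarith
  eta_update n := by
    ext ⟨v, w, hw⟩
    exact h.eta_update n v w (by simpa using hw)

theorem IsADMM.exists_tendsto {f : V → ℝ → ℝ} {lam ρ : ℝ} {x : ℕ → V → ℝ}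
    {z η : ℕ → V → V → ℝ} (h : IsADMM G f lam ρ x z η) (hdeg : ∀ v, 0 < G.degree v)
    (hconv : ∀ v, ConvexOn ℝ Set.univ (f v)) (hlam : 0 < lam) (hρ : 0 < ρ)
    (hmin : ∃ y, IsRegMinimizer G f lam y) :
    ∃ xs, IsRegMinimizer G f lam xs ∧ Tendsto x atTop (𝓝 xs) := by
  simp only [IsRegMinimizer, energy_eq] at hmin ⊢
  exact h.isAbstractADMM.exists_tendsto hρ (convexOn_sum_apply hconv)
    (convexOn_splitPenalty hlam.le) (targetValues_injective hdeg) hmin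

end Graph

end TVConsensus

theorem mainTheorem8 {V : Type*} [Fintype V] [DecidableEq V] (G : SimpleGraph V)
    [DecidableRel G.Adj] (hdeg : ∀ v : V, 0 < G.degree v)
    (f : V → ℝ → ℝ)
    (hconv : ∀ v : V, ConvexOn ℝ Set.univ (f v))
    (hmin : ∃ a : ℝ, ∀ b : ℝ, ∑ v, f v a ≤ ∑ v, f v b)
    (lam ρ : ℝ) (hlam : 0 < lam) (hρ : 0 < ρ)
    (x : ℕ → V → ℝ) (μ : ℕ → V → V → ℝ)
    (hseq : TVConsensus.IsDistributedADMM G f lam ρ x μ) :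
    (∃ z η : ℕ → V → V → ℝ, TVConsensus.IsADMM G f lam ρ x z η ∧
      ∀ (n : ℕ) (v w : V), G.Adj v w → η n v w = ρ / 2 * μ (n + 1) v w) ∧
    ((∃ y : V → ℝ, TVConsensus.IsRegMinimizer G f lam y) →
      ∃ xstar : V → ℝ, TVConsensus.IsRegMinimizer G f lam xstar ∧
        Tendsto x atTop (𝓝 xstar)) ∧
    ((∀ (v : V) (y : ℝ), f v y = 1 / 2 * (y - x 0 v) ^ 2) →
      ∀ d : ℕ, G.IsRegularOfDegree d →
        ∀ n : ℕ, TVConsensus.average (x n) = TVConsensus.average (x 0)) := by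
  have hadmm := hseq.isADMM hdeg hconv hlam hρ
  exact ⟨⟨_, _, hadmm, fun _ _ _ _ => rfl⟩, hadmm.exists_tendsto hdeg hconv hlam hρ,
    fun hf _ hreg n => hseq.average_eq hdeg hconv hlam hρ hf hreg n⟩
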